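/- Let $\mathsf{Pos}$ be the category of posets and monotone maps, and fix a representative set $\mathsf{Pos}_f$ of finite posets up to isomorphism, whose members are called contexts. A signature is a family $\Sigma=(\Sigma_\Gamma)_{\Gamma\in\mathsf{Pos}_f}$ of sets. A $\Sigma$-algebra is a poset $A$ with a map $\sigma_A\colon \mathsf{Pos}(\Gamma,A)\to A$ (not necessarily monotone) for each context $\Gamma$ and each $\sigma\in\Sigma_\Gamma$; it is coherent if every $\sigma_A$ is monotone for the pointwise order on $\mathsf{Pos}(\Gamma,A)$. Homomorphisms are the monotone maps that commute with the operations. The terms in context $\Gamma$ form the least set that contains the elements of $\Gamma$ (the variables) and contains $\sigma(g)$ for all contexts $\Delta$, all $\sigma\in\Sigma_\Delta$ and all maps $g$ from the underlying set of $\Delta$ to the set of terms. Given a monotone map $f\colon\Gamma\to A$, the partial evaluation map $f^\#$ from terms to $A$ is defined by $f^\#(x)=f(x)$ for variables $x$ and $f^\#(\sigma(g))=\sigma_A(f^\#\cdot g)$, where the latter is defined iff all $f^\#(g(i))$ are defined and $i\le j$ in $\Delta$ implies $f^\#(g(i))\le f^\#(g(j))$. The algebra $A$ satisfies an inequation $\Gamma\vdash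 s\le t$ between terms in context $\Gamma$ if for every monotone $f\colon\Gamma\to A$ both $f^\#(s)$ and $f^\#(t)$ are defined and $f^\#(s)\le f^\#(t)$; an equation $\Gamma\vdash s=t$ stands for the two inequations $\Gamma\vdash s\le t$ and $\Gamma\vdash t\le s$. A variety of coherent algebras is the full subcategory of all coherent $\Sigma$-algebras that satisfy a given set of inequations in context, for some signature $\Sigma$. A monad $\mathbb T=(T,\eta,\mu)$ on $\mathsf{Pos}$ is finitary if $T$ preserves filtered colimits, and enriched if $f_1\le f_2$ (pointwise) implies $Tf_1\le Tf_2$ for all monotone maps $f_1,f_2\colon X\to Y$. The variety $\mathcal V_{\mathbb T}$ associated with a finitary monad $\mathbb T$ has as operation symbols of arity $\Gamma$ the elements of $T\Gamma$, and consists of all algebras for this signature that satisfy the following, where a symbol $\sigma\in T\Gamma$ also denotes the term $\sigma(x)_{x\in\Gamma}$ in context $\Gamma$: 1. $\Gamma\vdash\sigma\le\tau$ for all $\sigma\le\tau$ in $T\Gamma$; 2. $\Gamma\vdash k^*(\sigma)=\sigma(k)$ for all contexts $\Delta$, all monotone $k\colon\Delta\to T\Gamma$ and all $\sigma\in T\Delta$,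 where $k^*=\mu_\Gamma\cdot Tk$; 3. $\Gamma\vdash\eta_\Gamma(x)=x$ for all $x\in\Gamma$. Proposition. (a) If $\mathbb T$ is an enriched finitary monad on $\mathsf{Pos}$, then all algebras of the associated variety $\mathcal V_{\mathbb T}$ are coherent. (b) Conversely, for every variety $\mathcal V$ of coherent algebras, the forgetful functor $\mathcal V\to\mathsf{Pos}$ has a left adjoint, and the induced free-algebra monad $\mathbb T_{\mathcal V}$ is enriched, i.e. $f_1\le f_2$ in $\mathsf{Pos}(X,Y)$ implies $T_{\mathcal V}f_1\le T_{\mathcal V}f_2$. -/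

import Mathlib

open CategoryTheory

universe u

namespace OrderedAlgebra

/-- A representative set of finite posets up to isomorphism: a set of finite posets, called
contexts, such that every finite poset is isomorphic to exactly one of them. -/
structure Contexts where
  /-- The (small) set of contexts. -/
  Idx : Type u
  /-- The poset that is the context. -/
  poset : Idx → PartOrd.{u}
  finite : ∀ Γ, Finite (poset Γ)
  exists_iso : ∀ (P : Type u) [PartialOrder P] [Finite P], ∃ Γ, Nonempty (P ≃o poset Γ)
  eq_of_iso : ∀ Γ Δ, Nonempty (poset Γ ≃o poset Δ) → Γ = Δ

variable {R : Contexts.{u}}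

/-- A signature in context: a set of operation symbols for each context (their arity). -/
abbrev Signature (R : Contexts.{u}) : Type (u + 1) := R.Idx → Type u

/-- An ordered algebra: a poset `A` with a map `σ_A` from the set of monotone maps `Γ → A` to `A`
for each operation symbol `σ` of arity `Γ`. The operations need not be monotone. -/
structure Alg (S : Signature R) where
  /-- The underlying poset. -/
  carrier : PartOrd.{u}
  /-- The operations. -/
  op : ∀ {Γ : R.Idx}, S Γ → (R.poset Γ →o carrier) → carrier

namespace Alg

variable {S : Signature R}

/-- An algebra is coherent if its operations are monotone, for the pointwise order on the
monotone maps `Γ → A`. -/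
def Coherent (A : Alg S) : Prop :=
  ∀ (Γ : R.Idx) (σ : S Γ), Monotone (A.op σ)

/-- Homomorphisms: monotone maps that commute with the operations. -/
@[ext]
structure Hom (A B : Alg S) where
  /-- The underlying monotone map. -/
  toOrderHom : A.carrier →o B.carrier
  map_op : ∀ (Γ : R.Idx) (σ : S Γ) (f : R.poset Γ →o A.carrier),
    toOrderHom (A.op σ f) = B.op σ (toOrderHom.comp f)

instance : Category (Alg S) where
  Hom := Hom
  id A := ⟨OrderHom.id, fun _ _ _ => rfl⟩
  comp h k := ⟨k.toOrderHom.comp h.toOrderHom, fun Γ σ f => by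
    simp only [OrderHom.comp_coe, Function.comp_apply, h.map_op, k.map_op]
    rfl⟩

/-- The forgetful functor from ordered algebras to posets. -/
def forget (S : Signature R) : Alg S ⥤ PartOrd.{u} where
  obj A := A.carrier
  map h := PartOrd.ofHom h.toOrderHom

end Alg

/-- Terms over a set `V` of variables; the order of the arities is ignored. -/
inductive Term (S : Signature R) (V : Type u) : Type u
  | var : V → Term S V
  | app {Δ : R.Idx} (σ : S Δ) (g : R.poset Δ → Term S V) : Term S V

/-- An operation symbol `σ` of arity `Γ` regarded as the term `σ(x₁, …, xₙ)` in the
variables of `Γ`. -/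
def Term.ofSymbol {S : Signature R} {Γ : R.Idx} (σ : S Γ) : Term S (R.poset Γ) :=
  .app σ .var

/-- Evaluation of terms in context `Γ` under a monotone interpretation `f : Γ → A`, a partial map:
the value of `σ(g)` is defined iff the values of all terms `g i` are defined and depend
monotonically on `i`. -/
def Alg.eval {S : Signature R} (A : Alg S) {Γ : R.Idx} (f : R.poset Γ →o A.carrier) :
    Term S (R.poset Γ) → Part A.carrier
  | .var x => Part.some (f x)
  | .app σ g =>
    { Dom := ∃ h : ∀ i, (A.eval f (g i)).Dom,
        ∀ i j, i ≤ j → (A.eval f (g i)).get (h i) ≤ (A.eval f (g j)).get (h j)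
      get := fun H => A.op σ ⟨fun i => (A.eval f (g i)).get (H.1 i), fun i j hij => H.2 i j hij⟩ }

/-- An inequation `Γ ⊢ lhs ≤ rhs` in context. -/
structure Inequation (S : Signature R) where
  /-- The context. -/
  ctx : R.Idx
  /-- The smaller term. -/
  lhs : Term S (R.poset ctx)
  /-- The larger term. -/
  rhs : Term S (R.poset ctx)

/-- `A` satisfies `Γ ⊢ s ≤ t` if for every monotone `f : Γ → A` the values of `s` and `t` under `f`
are both defined and the former is below the latter. -/
def Alg.Satisfies {S : Signature R} (A : Alg S) (e : Inequation S) : Prop :=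
  ∀ f : R.poset e.ctx →o A.carrier, ∃ (hl : (A.eval f e.lhs).Dom) (hr : (A.eval f e.rhs).Dom),
    (A.eval f e.lhs).get hl ≤ (A.eval f e.rhs).get hr

/-- The objects of the variety of ordered algebras specified by a set `E` of inequations. -/
def variety {S : Signature R} (E : Set (Inequation S)) : ObjectProperty (Alg S) :=
  fun A => ∀ e ∈ E, A.Satisfies e

/-- The objects of the variety of coherent algebras specified by a set `E` of inequations. -/
def coherentVariety {S : Signature R} (E : Set (Inequation S)) : ObjectProperty (Alg S) :=
  fun A => A.Coherent ∧ variety E A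

/-- The forgetful functor to posets of the variety of coherent algebras specified by `E`, a full
subcategory of the category of all ordered algebras. -/
def coherentForget {S : Signature R} (E : Set (Inequation S)) :
    (coherentVariety E).FullSubcategory ⥤ PartOrd.{u} :=
  (coherentVariety E).ι ⋙ Alg.forget S

/-- A monad on posets is enriched if its endofunctor is locally monotone: `f ≤ g` pointwise
implies `T f ≤ T g` pointwise. -/
def Enriched (T : Monad PartOrd.{u}) : Prop :=
  ∀ ⦃X Y : PartOrd.{u}⦄ (f g : X ⟶ Y), f.hom ≤ g.hom → (T.map f).hom ≤ (T.map g).hom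

/-- The signature associated with a monad `T`: the operation symbols of arity `Γ` are the elements
of `T Γ`. -/
def assocSignature (R : Contexts.{u}) (T : Monad PartOrd.{u}) : Signature R :=
  fun Γ => T.obj (R.poset Γ)

/-- An element of `T Γ` as an operation symbol of arity `Γ`. -/
def symb {T : Monad PartOrd.{u}} {Γ : R.Idx} (σ : T.obj (R.poset Γ)) : assocSignature R T Γ := σ

/-- The Kleisli extension `k* = μ_Y ∘ T k : T X → T Y` of `k : X → T Y`. -/
def kleisliExt (T : Monad PartOrd.{u}) {X Y : PartOrd.{u}} (k : X ⟶ T.obj Y) :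
    T.obj X ⟶ T.obj Y :=
  T.map k ≫ T.μ.app Y

/-- The inequations that define the variety associated with a monad `T`. -/
inductive AssocInequation (R : Contexts.{u}) (T : Monad PartOrd.{u}) :
    Inequation (assocSignature R T) → Prop
  /-- `Γ ⊢ σ ≤ τ` for `σ ≤ τ` in `T Γ`. -/
  | le (Γ : R.Idx) (σ τ : T.obj (R.poset Γ)) (h : σ ≤ τ) :
      AssocInequation R T ⟨Γ, .ofSymbol (symb σ), .ofSymbol (symb τ)⟩
  /-- `Γ ⊢ k*(σ) ≤ σ(k)` for monotone `k : Δ → T Γ` and `σ ∈ T Δ`. -/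
  | ext_le (Γ Δ : R.Idx) (k : R.poset Δ ⟶ T.obj (R.poset Γ)) (σ : T.obj (R.poset Δ)) :
      AssocInequation R T ⟨Γ, .ofSymbol (symb (kleisliExt T k σ)),
        .app (symb σ) (fun i => .ofSymbol (symb (k i)))⟩
  /-- `Γ ⊢ σ(k) ≤ k*(σ)` for monotone `k : Δ → T Γ` and `σ ∈ T Δ`. -/
  | le_ext (Γ Δ : R.Idx) (k : R.poset Δ ⟶ T.obj (R.poset Γ)) (σ : T.obj (R.poset Δ)) :
      AssocInequation R T ⟨Γ, .app (symb σ) (fun i => .ofSymbol (symb (k i))),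
        .ofSymbol (symb (kleisliExt T k σ))⟩
  /-- `Γ ⊢ η(x) ≤ x` for `x ∈ Γ`. -/
  | unit_le (Γ : R.Idx) (x : R.poset Γ) :
      AssocInequation R T ⟨Γ, .ofSymbol (symb (T.η.app (R.poset Γ) x)), .var x⟩
  /-- `Γ ⊢ x ≤ η(x)` for `x ∈ Γ`. -/
  | le_unit (Γ : R.Idx) (x : R.poset Γ) :
      AssocInequation R T ⟨Γ, .var x, .ofSymbol (symb (T.η.app (R.poset Γ) x))⟩

/-- The set of inequations that define the variety associated with a monad `T`. -/
def assocInequations (R : Contexts.{u}) (T : Monad PartOrd.{u}) :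
    Set (Inequation (assocSignature R T)) :=
  {e | AssocInequation R T e}

end OrderedAlgebra

/-!
(a) The operations of an algebra of `𝒱_T` extend every `f : Γ → A` to a monotone map
`f^♯ : T Γ → A`, and `f^♯ · T j = (f · j)^♯`. If `v ≤ w : Γ → A`, glue them to one monotone map
`f : Γ × {0 < 1} → A`, whose domain is again a context. The two inclusions `i ≤ j` of `Γ` satisfy
`T i ≤ T j`, so `v^♯ = f^♯ · T i ≤ f^♯ · T j = w^♯`.

(b) The free algebra on `X` consists of the terms over `X` that have a value in every algebra of the
class, modulo having the same values; it lies in the class because inequations in context are stable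
under substitution. Since every element of a free algebra is the value of a term at the unit, and
the value of a term in a coherent algebra depends monotonically on the values of its variables, the
free-algebra monad is enriched.
-/

namespace OrderedAlgebra

variable {R : Contexts.{u}} {S : Signature R}

/-- Simultaneous substitution of terms for variables. -/
def Term.bind {V W : Type u} (s : V → Term S W) : Term S V → Term S W
  | .var x => s x
  | .app σ g => .app σ fun i => (g i).bind s

namespace Alg

/-- The graph of the partial evaluation of terms over an arbitrary set `V` of variables, which,
unlike a context, need be neither finite nor ordered. -/
inductive Evaluates (A : Alg S) {V : Type u} (f : V → A.carrier) : Term S V → A.carrier → Prop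
  | var (x : V) : Evaluates A f (.var x) (f x)
  | app {Δ : R.Idx} (σ : S Δ) (g : R.poset Δ → Term S V) (v : R.poset Δ →o A.carrier)
      (h : ∀ i, Evaluates A f (g i) (v i)) : Evaluates A f (.app σ g) (A.op σ v)

namespace Evaluates

variable {A : Alg S} {V : Type u} {f : V → A.carrier}

theorem var_iff {x : V} {a : A.carrier} : A.Evaluates f (.var x) a ↔ a = f x :=
  ⟨fun h => by cases h; rfl, fun h => h ▸ .var x⟩

theorem app_iff {Δ : R.Idx} {σ : S Δ} {g : R.poset Δ → Term S V} {a : A.carrier} :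
    A.Evaluates f (.app σ g) a ↔
      ∃ v : R.poset Δ →o A.carrier, (∀ i, A.Evaluates f (g i) (v i)) ∧ a = A.op σ v :=
  ⟨fun h => by cases h with | app _ _ v h => exact ⟨v, h, rfl⟩,
    fun ⟨v, h, ha⟩ => ha ▸ .app σ g v h⟩

theorem ofSymbol {Γ : R.Idx} (σ : S Γ) (f : R.poset Γ →o A.carrier) :
    A.Evaluates f (.ofSymbol σ) (A.op σ f) :=
  .app σ _ f .var

theorem unique {t : Term S V} {a b : A.carrier} (ha : A.Evaluates f t a)
    (hb : A.Evaluates f t b) : a = b := by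
  induction ha generalizing b with
  | var x => exact (var_iff.1 hb).symm
  | app σ g v _ ih =>
    obtain ⟨w, hw, rfl⟩ := app_iff.1 hb
    exact congrArg (A.op σ) (OrderHom.ext _ _ (funext fun i => ih i (hw i)))

theorem mono {f' : V → A.carrier} (hA : A.Coherent) (hf : ∀ x, f x ≤ f' x) {t : Term S V}
    {a b : A.carrier} (ha : A.Evaluates f t a) (hb : A.Evaluates f' t b) : a ≤ b := by
  induction ha generalizing b with
  | var x => exact (hf x).trans_eq (var_iff.1 hb).symm
  | app σ g v _ ih =>
    obtain ⟨w, hw, rfl⟩ := app_iff.1 hb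
    exact hA _ σ fun i => ih i (hw i)

theorem map {B : Alg S} (h : Hom A B) {t : Term S V} {a : A.carrier} (ha : A.Evaluates f t a) :
    B.Evaluates (fun x => h.toOrderHom (f x)) t (h.toOrderHom a) := by
  induction ha with
  | var x => exact .var x
  | app σ g v _ ih => exact h.map_op _ σ v ▸ .app σ g (h.toOrderHom.comp v) ih

theorem bind_iff {W : Type u} {s : W → Term S V} {w : W → A.carrier}
    (hs : ∀ x, A.Evaluates f (s x) (w x)) {t : Term S W} {a : A.carrier} :
    A.Evaluates f (t.bind s) a ↔ A.Evaluates w t a := by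
  induction t generalizing a with
  | var x => exact ⟨fun h => var_iff.2 (h.unique (hs x)), fun h => var_iff.1 h ▸ hs x⟩
  | app σ g ih => simp only [Term.bind, app_iff, ih]

end Evaluates

theorem mem_eval_iff {A : Alg S} {Γ : R.Idx} {f : R.poset Γ →o A.carrier}
    {t : Term S (R.poset Γ)} {a : A.carrier} : a ∈ A.eval f t ↔ A.Evaluates f t a := by
  induction t generalizing a with
  | var x => simp only [eval, Part.mem_some_iff, Evaluates.var_iff]
  | app σ g ih =>
    rw [Evaluates.app_iff, eval]
    constructor
    · rintro ⟨hdom, rfl⟩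
      exact ⟨_, fun i => (ih i).1 (Part.get_mem (hdom.1 i)), rfl⟩
    · rintro ⟨v, hv, rfl⟩
      have hget : ∀ i, ∃ hi, (A.eval f (g i)).get hi = v i := fun i => (ih i).2 (hv i)
      refine ⟨⟨fun i => (hget i).1, fun i j hij => ?_⟩, ?_⟩
      · simpa only [(hget i).2, (hget j).2] using v.monotone hij
      · exact congrArg (A.op σ) (OrderHom.ext _ _ (funext fun i => (hget i).2))

theorem satisfies_iff {A : Alg S} {e : Inequation S} :
    A.Satisfies e ↔ ∀ f : R.poset e.ctx →o A.carrier,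
      ∃ a b, A.Evaluates f e.lhs a ∧ A.Evaluates f e.rhs b ∧ a ≤ b := by
  refine forall_congr' fun f => ?_
  simp only [← mem_eval_iff]
  constructor
  · rintro ⟨hl, hr, h⟩
    exact ⟨_, _, Part.get_mem hl, Part.get_mem hr, h⟩
  · rintro ⟨_, _, ⟨hl, rfl⟩, ⟨hr, rfl⟩, h⟩
    exact ⟨hl, hr, h⟩

theorem Satisfies.le_of_evaluates {A : Alg S} {e : Inequation S} (hA : A.Satisfies e)
    {f : R.poset e.ctx →o A.carrier} {a b : A.carrier} (ha : A.Evaluates f e.lhs a)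
    (hb : A.Evaluates f e.rhs b) : a ≤ b := by
  obtain ⟨a', b', ha', hb', hab⟩ := satisfies_iff.1 hA f
  rwa [ha.unique ha', hb.unique hb']

theorem Satisfies.exists_evaluates_bind {A : Alg S} {e : Inequation S} (hA : A.Satisfies e)
    {V : Type u} {f : V → A.carrier} {s : R.poset e.ctx → Term S V} {w : R.poset e.ctx →o A.carrier}
    (hs : ∀ x, A.Evaluates f (s x) (w x)) :
    ∃ a b, A.Evaluates f (e.lhs.bind s) a ∧ A.Evaluates f (e.rhs.bind s) b ∧ a ≤ b := by
  simpa only [Evaluates.bind_iff hs] using satisfies_iff.1 hA w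

end Alg

section AssociatedVariety

theorem Contexts.exists_comp_eq_of_le (R : Contexts.{u}) {P : Type u} [PartialOrder P] [Finite P]
    {A : Type*} [Preorder A] {v w : P →o A} (hvw : v ≤ w) :
    ∃ (Δ : R.Idx) (i j : P →o R.poset Δ) (f : R.poset Δ →o A),
      i ≤ j ∧ f.comp i = v ∧ f.comp j = w := by
  obtain ⟨Δ, ⟨e⟩⟩ := R.exists_iso (ULift.{u} Bool × P)
  let family : ULift.{u} Bool →o (P →o A) :=
    ⟨fun b => cond b.down w v, by
      rintro ⟨_ | _⟩ ⟨_ | _⟩ hbc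
      exacts [le_rfl, hvw, absurd hbc (by decide), le_rfl]⟩
  let incl (b : Bool) : P →o R.poset Δ :=
    (e : _ →o R.poset Δ).comp ((OrderHom.const P (ULift.up b)).prod OrderHom.id)
  let glued : R.poset Δ →o A := (OrderHom.curry.symm family).comp (e.symm : R.poset Δ →o _)
  have glued_comp_incl (b : Bool) : glued.comp (incl b) = cond b w v :=
    OrderHom.ext _ _ (funext fun x =>
      congrArg (OrderHom.curry.symm family) (e.symm_apply_apply (⟨b⟩, x)))
  exact ⟨Δ, incl false, incl true, glued,
    fun x => e.monotone ⟨Bool.false_le true, le_refl x⟩, glued_comp_incl _, glued_comp_incl _⟩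

theorem kleisliExt_comp_unit (T : Monad PartOrd.{u}) {X Y : PartOrd.{u}} (j : X ⟶ Y) :
    kleisliExt T (j ≫ T.η.app Y) = T.map j := by
  simp [kleisliExt]

variable {T : Monad PartOrd.{u}} {A : Alg (assocSignature R T)} {Γ Δ : R.Idx}

/-- The extension `f^♯ : T Γ → A` of `f : Γ → A` to the operation symbols of arity `Γ`, in an
algebra of the variety associated with `T`. -/
def symbolEval (hA : variety (assocInequations R T) A) (f : R.poset Γ →o A.carrier) :
    T.obj (R.poset Γ) →o A.carrier where
  toFun σ := A.op (symb σ) f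
  monotone' σ τ h := (hA _ (.le Γ σ τ h)).le_of_evaluates (.ofSymbol _ f) (.ofSymbol _ f)

variable (hA : variety (assocInequations R T) A)
include hA

theorem symbolEval_unit (f : R.poset Γ →o A.carrier) (x : R.poset Γ) :
    symbolEval hA f (T.η.app (R.poset Γ) x) = f x :=
  le_antisymm ((hA _ (.unit_le Γ x)).le_of_evaluates (.ofSymbol _ f) (.var x))
    ((hA _ (.le_unit Γ x)).le_of_evaluates (.var x) (.ofSymbol _ f))

theorem symbolEval_kleisliExt (f : R.poset Γ →o A.carrier) (k : R.poset Δ ⟶ T.obj (R.poset Γ))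
    (σ : T.obj (R.poset Δ)) :
    symbolEval hA f (kleisliExt T k σ) = symbolEval hA ((symbolEval hA f).comp k.hom) σ :=
  have h : A.Evaluates f (.app (symb σ) fun i => .ofSymbol (symb (k i)))
      (symbolEval hA ((symbolEval hA f).comp k.hom) σ) :=
    .app _ _ ((symbolEval hA f).comp k.hom) fun i => .ofSymbol (symb (k i)) f
  le_antisymm ((hA _ (.ext_le Γ Δ k σ)).le_of_evaluates (.ofSymbol _ f) h)
    ((hA _ (.le_ext Γ Δ k σ)).le_of_evaluates h (.ofSymbol _ f))

theorem symbolEval_map (f : R.poset Δ →o A.carrier) (j : R.poset Γ ⟶ R.poset Δ)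
    (σ : T.obj (R.poset Γ)) :
    symbolEval hA f (T.map j σ) = symbolEval hA (f.comp j.hom) σ := by
  have hj : (symbolEval hA f).comp (j ≫ T.η.app _).hom = f.comp j.hom :=
    OrderHom.ext _ _ (funext fun x => symbolEval_unit hA f (j x))
  rw [← kleisliExt_comp_unit, symbolEval_kleisliExt, hj]

theorem coherent_of_enriched (hT : Enriched T) : A.Coherent := by
  intro Γ σ v w hvw
  have := R.finite Γ
  obtain ⟨Δ, i, j, f, hij, rfl, rfl⟩ := R.exists_comp_eq_of_le hvw
  calc symbolEval hA (f.comp i) σ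
      = symbolEval hA f (T.map (PartOrd.ofHom i) σ) := (symbolEval_map hA f _ σ).symm
    _ ≤ symbolEval hA f (T.map (PartOrd.ofHom j) σ) := (symbolEval hA f).monotone (hT _ _ hij σ)
    _ = symbolEval hA (f.comp j) σ := symbolEval_map hA f _ σ

end AssociatedVariety

section FreeAlgebra

variable (K : ObjectProperty (Alg S)) (X : PartOrd.{u})

/-- The terms over `X` that have a value in every algebra of the class `K` under every monotone
interpretation of the variables. -/
@[ext]
structure DefinedTerm where
  /-- The underlying term. -/
  term : Term S X
  exists_evaluates : ∀ (B : K.FullSubcategory) (f : X →o B.obj.carrier),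
    ∃ a, B.obj.Evaluates f term a

variable {K X}

namespace DefinedTerm

/-- `s ≤ t` if the value of `s` is below the value of `t` throughout the class. -/
instance : Preorder (DefinedTerm K X) where
  le s t := ∀ (B : K.FullSubcategory) (f : X →o B.obj.carrier) (a b : B.obj.carrier),
    B.obj.Evaluates f s.term a → B.obj.Evaluates f t.term b → a ≤ b
  le_refl _ _ _ _ _ ha hb := (ha.unique hb).le
  le_trans _ t _ hst htu B f a c ha hc :=
    have ⟨b, hb⟩ := t.exists_evaluates B f
    (hst B f a b ha hb).trans (htu B f b c hb hc)

variable (B : K.FullSubcategory) (f : X →o B.obj.carrier)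

/-- The value of a term that is defined throughout the class. -/
noncomputable def value : DefinedTerm K X →o B.obj.carrier where
  toFun t := (t.exists_evaluates B f).choose
  monotone' s t h :=
    h B f _ _ (s.exists_evaluates B f).choose_spec (t.exists_evaluates B f).choose_spec

theorem evaluates_value (t : DefinedTerm K X) : B.obj.Evaluates f t.term (value B f t) :=
  (t.exists_evaluates B f).choose_spec

variable {B f} in
theorem value_eq {t : DefinedTerm K X} {a : B.obj.carrier} (h : B.obj.Evaluates f t.term a) :
    value B f t = a :=
  (t.evaluates_value B f).unique h

theorem le_iff_value {s t : DefinedTerm K X} :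
    s ≤ t ↔ ∀ (B : K.FullSubcategory) (f : X →o B.obj.carrier), value B f s ≤ value B f t :=
  ⟨fun h B f => (value B f).monotone h, fun h B f _ _ ha hb => value_eq ha ▸ value_eq hb ▸ h B f⟩

/-- A variable as a term that is defined throughout the class. -/
def var : X →o DefinedTerm K X where
  toFun x := ⟨.var x, fun _ f => ⟨f x, .var x⟩⟩
  monotone' _ _ hxy _ f _ _ ha hb := by
    rw [Alg.Evaluates.var_iff.1 ha, Alg.Evaluates.var_iff.1 hb]
    exact f.monotone hxy

theorem value_var (x : X) : value B f (var x) = f x :=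
  value_eq (.var x)

theorem evaluates_app {Δ : R.Idx} (σ : S Δ) (g : R.poset Δ →o DefinedTerm K X) :
    B.obj.Evaluates f (.app σ fun i => (g i).term) (B.obj.op σ ((value B f).comp g)) :=
  .app σ _ _ fun i => (g i).evaluates_value B f

/-- An operation symbol applied to a monotone family of terms that are defined throughout the
class. -/
def app {Δ : R.Idx} (σ : S Δ) (g : R.poset Δ →o DefinedTerm K X) : DefinedTerm K X :=
  ⟨.app σ fun i => (g i).term, fun B f => ⟨_, evaluates_app B f σ g⟩⟩

theorem value_app {Δ : R.Idx} (σ : S Δ) (g : R.poset Δ →o DefinedTerm K X) :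
    value B f (app σ g) = B.obj.op σ ((value B f).comp g) :=
  value_eq (evaluates_app B f σ g)

theorem exists_eq_app {Δ : R.Idx} {σ : S Δ} {g : R.poset Δ → Term S X} (t : DefinedTerm K X)
    (ht : t.term = .app σ g) :
    ∃ d : R.poset Δ →o DefinedTerm K X, (∀ i, (d i).term = g i) ∧ t = app σ d := by
  have exists_values (B : K.FullSubcategory) (f : X →o B.obj.carrier) :
      ∃ v : R.poset Δ →o B.obj.carrier, ∀ i, B.obj.Evaluates f (g i) (v i) := by
    obtain ⟨a, ha⟩ := t.exists_evaluates B f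
    obtain ⟨v, hv, -⟩ := Alg.Evaluates.app_iff.1 (ht ▸ ha)
    exact ⟨v, hv⟩
  let d : R.poset Δ →o DefinedTerm K X :=
    { toFun := fun i => ⟨g i, fun B f => (exists_values B f).imp' (· i) fun _ hv => hv i⟩
      monotone' := fun i j hij B f a b ha hb => by
        obtain ⟨v, hv⟩ := exists_values B f
        rw [ha.unique (hv i), hb.unique (hv j)]
        exact v.monotone hij }
  exact ⟨d, fun _ => rfl, DefinedTerm.ext ht⟩

@[elab_as_elim]
theorem induction {motive : DefinedTerm K X → Prop} (var : ∀ x, motive (var x))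
    (app : ∀ {Δ : R.Idx} (σ : S Δ) (g : R.poset Δ →o DefinedTerm K X),
      (∀ i, motive (g i)) → motive (app σ g)) (t : DefinedTerm K X) : motive t := by
  induction h : t.term generalizing t with
  | var x =>
    obtain rfl : t = DefinedTerm.var x := DefinedTerm.ext h
    exact var x
  | app σ g ih =>
    obtain ⟨d, hd, rfl⟩ := exists_eq_app t h
    exact app σ d fun i => ih i (d i) (hd i)

end DefinedTerm

open DefinedTerm

variable (K X) in
/-- The underlying poset of the free algebra: the terms that are defined throughout the class,
modulo having the same values. -/
abbrev FreePoset : Type u := Antisymmetrization (DefinedTerm K X) (· ≤ ·)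

namespace FreePoset

/-- The class of a term. -/
def mk : DefinedTerm K X →o FreePoset K X :=
  ⟨toAntisymmetrization _, toAntisymmetrization_mono⟩

/-- A term representing a given class. -/
noncomputable def rep : FreePoset K X →o DefinedTerm K X :=
  (OrderEmbedding.ofAntisymmetrization (DefinedTerm K X)).toOrderHom

theorem mk_rep (q : FreePoset K X) : mk (rep q) = q :=
  toAntisymmetrization_ofAntisymmetrization _ q

/-- The common value of the terms in a class. -/
noncomputable def value (B : K.FullSubcategory) (f : X →o B.obj.carrier) :
    FreePoset K X →o B.obj.carrier where
  toFun := Quotient.lift (DefinedTerm.value B f) fun _ _ h =>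
    le_antisymm ((DefinedTerm.value B f).monotone h.1) ((DefinedTerm.value B f).monotone h.2)
  monotone' := Quotient.ind₂ fun _ _ h => (DefinedTerm.value B f).monotone h

theorem le_iff_value {p q : FreePoset K X} :
    p ≤ q ↔ ∀ (B : K.FullSubcategory) (f : X →o B.obj.carrier), value B f p ≤ value B f q :=
  Quotient.inductionOn₂ p q fun _ _ => DefinedTerm.le_iff_value

theorem ext_value {p q : FreePoset K X}
    (h : ∀ (B : K.FullSubcategory) (f : X →o B.obj.carrier), value B f p = value B f q) : p = q :=
  le_antisymm (le_iff_value.2 fun B f => (h B f).le) (le_iff_value.2 fun B f => (h B f).ge)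

end FreePoset

variable (K X) in
/-- The free algebra on `X` relative to the class `K`, which need not itself lie in `K`. The
operations are evaluated at representatives, so that a monotone family of classes becomes a monotone
family of terms. -/
noncomputable def freeAlg : Alg S where
  carrier := PartOrd.of (FreePoset K X)
  op σ g := FreePoset.mk (app σ (FreePoset.rep.comp g))

/-- The homomorphism from the free algebra that extends a monotone map `f : X → B`. -/
noncomputable def freeLift (B : K.FullSubcategory) (f : X →o B.obj.carrier) :
    Alg.Hom (freeAlg K X) B.obj where
  toOrderHom := FreePoset.value B f
  map_op _ σ g := (value_app B f σ _).trans <| congrArg (B.obj.op σ) <| OrderHom.ext _ _ <|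
    funext fun i => congrArg (FreePoset.value B f) (FreePoset.mk_rep (g i))

theorem freeAlg_op_mk_comp {Δ : R.Idx} (σ : S Δ) (g : R.poset Δ →o DefinedTerm K X) :
    (freeAlg K X).op σ (FreePoset.mk.comp g) = FreePoset.mk (app σ g) :=
  FreePoset.ext_value fun B f =>
    ((freeLift B f).map_op Δ σ (FreePoset.mk.comp g)).trans (value_app B f σ g).symm

variable (K X) in
/-- The inclusion of the variables into the free algebra. -/
def freeVar : X →o FreePoset K X :=
  FreePoset.mk.comp DefinedTerm.var

theorem freeAlg_evaluates_mk (t : DefinedTerm K X) :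
    (freeAlg K X).Evaluates (freeVar K X) t.term (FreePoset.mk t) := by
  induction t using DefinedTerm.induction with
  | var x => exact .var x
  | app σ g ih =>
    rw [← freeAlg_op_mk_comp]
    exact .app σ _ _ fun i => ih i

theorem freeAlg_evaluates_bind {V : Type u} {s : V → DefinedTerm K X} {t : Term S V}
    {d : DefinedTerm K X} (hd : d.term = t.bind fun x => (s x).term) :
    (freeAlg K X).Evaluates (fun x => FreePoset.mk (s x)) t (FreePoset.mk d) :=
  (Alg.Evaluates.bind_iff fun x => freeAlg_evaluates_mk (s x)).1 (hd ▸ freeAlg_evaluates_mk d)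

theorem coherent_freeAlg (hK : ∀ A, K A → A.Coherent) : (freeAlg K X).Coherent := by
  refine fun Γ σ v w hvw => FreePoset.le_iff_value.2 fun B f => ?_
  calc (freeLift B f).toOrderHom ((freeAlg K X).op σ v)
      = B.obj.op σ ((freeLift B f).toOrderHom.comp v) := (freeLift B f).map_op Γ σ v
    _ ≤ B.obj.op σ ((freeLift B f).toOrderHom.comp w) :=
        hK _ B.property Γ σ fun i => (freeLift B f).toOrderHom.monotone (hvw i)
    _ = (freeLift B f).toOrderHom ((freeAlg K X).op σ w) := ((freeLift B f).map_op Γ σ w).symm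

theorem exists_definedTerm_bind_le {e : Inequation S} (hK : ∀ A, K A → A.Satisfies e)
    (s : R.poset e.ctx →o DefinedTerm K X) :
    ∃ l r : DefinedTerm K X, l.term = e.lhs.bind (fun x => (s x).term) ∧
      r.term = e.rhs.bind (fun x => (s x).term) ∧ l ≤ r := by
  have exists_values (B : K.FullSubcategory) (f : X →o B.obj.carrier) :=
    (hK _ B.property).exists_evaluates_bind (w := (value B f).comp s)
      fun x => (s x).evaluates_value B f
  refine ⟨⟨_, fun B f => (exists_values B f).imp fun _ ⟨_, ha, _⟩ => ha⟩,
    ⟨_, fun B f => (exists_values B f).elim fun _ ⟨b, _, hb, _⟩ => ⟨b, hb⟩⟩, rfl, rfl,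
    fun B f a b ha hb => ?_⟩
  obtain ⟨a', b', ha', hb', hab⟩ := exists_values B f
  rwa [ha.unique ha', hb.unique hb']

theorem satisfies_freeAlg {e : Inequation S} (hK : ∀ A, K A → A.Satisfies e) :
    (freeAlg K X).Satisfies e := by
  refine Alg.satisfies_iff.2 fun f => ?_
  obtain ⟨l, r, hl, hr, hlr⟩ := exists_definedTerm_bind_le hK (FreePoset.rep.comp f)
  have hf : (fun x => FreePoset.mk (FreePoset.rep (f x))) = f :=
    funext fun x => FreePoset.mk_rep (f x)
  exact ⟨FreePoset.mk l, FreePoset.mk r, hf ▸ freeAlg_evaluates_bind hl,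
    hf ▸ freeAlg_evaluates_bind hr, FreePoset.mk.monotone hlr⟩

theorem freeAlg_hom_ext {B : Alg S} {h k : Alg.Hom (freeAlg K X) B}
    (hhk : ∀ x, h.toOrderHom (freeVar K X x) = k.toOrderHom (freeVar K X x)) : h = k := by
  refine Alg.Hom.ext (OrderHom.ext _ _ (funext (Antisymmetrization.ind _ fun t => ?_)))
  exact ((freeAlg_evaluates_mk t).map h).unique
    (funext hhk ▸ (freeAlg_evaluates_mk t).map k)

/-- The universal property of the free algebra. -/
noncomputable def freeHomEquiv (hX : K (freeAlg K X)) (B : K.FullSubcategory) :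
    ((⟨freeAlg K X, hX⟩ : K.FullSubcategory) ⟶ B) ≃ (X ⟶ (K.ι ⋙ Alg.forget S).obj B) where
  toFun h := PartOrd.ofHom (h.hom.toOrderHom.comp (freeVar K X))
  invFun f := ObjectProperty.homMk (freeLift B f.hom)
  left_inv h := ObjectProperty.hom_ext _ <| freeAlg_hom_ext <|
    value_var B (h.hom.toOrderHom.comp (freeVar K X))
  right_inv f := PartOrd.ext (value_var B f.hom)

theorem isRightAdjoint_of_freeAlg_mem (hK : ∀ X, K (freeAlg K X)) :
    (K.ι ⋙ Alg.forget S).IsRightAdjoint :=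
  ⟨_, ⟨Adjunction.adjunctionOfEquivLeft (fun X B => freeHomEquiv (hK X) B)
    fun _ _ _ _ _ => rfl⟩⟩

variable {F : PartOrd.{u} ⥤ K.FullSubcategory} (adj : F ⊣ K.ι ⋙ Alg.forget S)

theorem exists_evaluates_unit (hX : K (freeAlg K X)) (a : (F.obj X).obj.carrier) :
    ∃ t, (F.obj X).obj.Evaluates (adj.unit.app X).hom t a := by
  let lift : (⟨freeAlg K X, hX⟩ : K.FullSubcategory) ⟶ F.obj X :=
    ObjectProperty.homMk (freeLift (F.obj X) (adj.unit.app X).hom)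
  let sec : F.obj X ⟶ ⟨freeAlg K X, hX⟩ :=
    (adj.homEquiv X _).symm (PartOrd.ofHom (freeVar K X))
  have lift_var : PartOrd.ofHom (freeVar K X) ≫ (K.ι ⋙ Alg.forget S).map lift = adj.unit.app X :=
    (freeHomEquiv hX (F.obj X)).apply_symm_apply (adj.unit.app X)
  have sec_lift : sec ≫ lift = 𝟙 (F.obj X) := calc
    sec ≫ lift = (adj.homEquiv X _).symm (PartOrd.ofHom (freeVar K X) ≫ _) :=
      (adj.homEquiv_naturality_right_symm _ lift).symm
    _ = (adj.homEquiv X _).symm (adj.unit.app X) := congrArg _ lift_var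
    _ = 𝟙 (F.obj X) := adj.homEquiv_symm_unit X
  have lift_sec_a : lift.hom.toOrderHom (sec.hom.toOrderHom a) = a :=
    ConcreteCategory.congr_hom (congrArg (K.ι ⋙ Alg.forget S).map sec_lift) a
  obtain ⟨t, ht⟩ : ∃ t, FreePoset.mk t = sec.hom.toOrderHom a := ⟨_, FreePoset.mk_rep _⟩
  have value_t : value (F.obj X) (adj.unit.app X).hom t = a :=
    (congrArg lift.hom.toOrderHom ht).trans lift_sec_a
  exact ⟨t.term, value_t ▸ t.evaluates_value _ _⟩

theorem Alg.Evaluates.map_unit {Y : PartOrd.{u}} (f : X ⟶ Y) {t : Term S X}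
    {a : (F.obj X).obj.carrier} (ha : (F.obj X).obj.Evaluates (adj.unit.app X).hom t a) :
    (F.obj Y).obj.Evaluates (fun x => adj.unit.app Y (f x)) t (adj.toMonad.map f a) := by
  have unit_naturality : (fun x => adj.toMonad.map f (adj.unit.app X x)) =
      fun x => adj.unit.app Y (f x) :=
    funext fun x => (ConcreteCategory.congr_hom (adj.unit.naturality f) x).symm
  exact unit_naturality ▸ ha.map (F.map f).hom

theorem enriched_toMonad (hcoh : ∀ A, K A → A.Coherent) (hfree : ∀ X, K (freeAlg K X)) :
    Enriched adj.toMonad := by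
  intro X Y f g hfg a
  obtain ⟨t, ht⟩ := exists_evaluates_unit adj (hfree X) a
  exact (ht.map_unit adj f).mono (hcoh _ (F.obj Y).property)
    (fun x => (adj.unit.app Y).hom.monotone (hfg x)) (ht.map_unit adj g)

theorem coherentVariety_freeAlg (E : Set (Inequation S)) (X : PartOrd.{u}) :
    coherentVariety E (freeAlg (coherentVariety E) X) :=
  ⟨coherent_freeAlg fun _ hA => hA.1, fun e he => satisfies_freeAlg fun _ hA => hA.2 e he⟩

end FreeAlgebra

end OrderedAlgebra

theorem propositionP_general (R : OrderedAlgebra.Contexts.{u}) :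
    (∀ T : Monad PartOrd.{u}, OrderedAlgebra.Enriched T →
      ∀ A : OrderedAlgebra.Alg (OrderedAlgebra.assocSignature R T),
        OrderedAlgebra.variety (OrderedAlgebra.assocInequations R T) A → A.Coherent) ∧
    (∀ (S : OrderedAlgebra.Signature R) (E : Set (OrderedAlgebra.Inequation S)),
      (OrderedAlgebra.coherentForget E).IsRightAdjoint ∧
      ∀ (F : PartOrd.{u} ⥤ (OrderedAlgebra.coherentVariety E).FullSubcategory)
        (adj : F ⊣ OrderedAlgebra.coherentForget E),
        OrderedAlgebra.Enriched adj.toMonad) := by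
  refine ⟨fun T hT A hA => OrderedAlgebra.coherent_of_enriched hA hT, fun S E => ⟨?_, ?_⟩⟩
  · exact OrderedAlgebra.isRightAdjoint_of_freeAlg_mem
      (OrderedAlgebra.coherentVariety_freeAlg E)
  · exact fun F adj => OrderedAlgebra.enriched_toMonad adj (fun _ hA => hA.1)
      (OrderedAlgebra.coherentVariety_freeAlg E)

/-- First part: for every enriched finitary monad `T`, all algebras of its associated variety are
coherent. Second part: every variety of coherent algebras has free algebras, and its free-algebra
monad (the monad of any adjunction `F ⊣ U` with `U` the forgetful functor) is enriched. -/
theorem propositionP (R : OrderedAlgebra.Contexts.{u}) :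
    (∀ T : Monad PartOrd.{u}, Limits.PreservesFilteredColimits T.toFunctor →
      OrderedAlgebra.Enriched T →
      ∀ A : OrderedAlgebra.Alg (OrderedAlgebra.assocSignature R T),
        OrderedAlgebra.variety (OrderedAlgebra.assocInequations R T) A → A.Coherent) ∧
    (∀ (S : OrderedAlgebra.Signature R) (E : Set (OrderedAlgebra.Inequation S)),
      (OrderedAlgebra.coherentForget E).IsRightAdjoint ∧
      ∀ (F : PartOrd.{u} ⥤ (OrderedAlgebra.coherentVariety E).FullSubcategory)
        (adj : F ⊣ OrderedAlgebra.coherentForget E),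
        OrderedAlgebra.Enriched adj.toMonad) := by
  exact ⟨fun T _ hT => (propositionP_general R).1 T hT, (propositionP_general R).2⟩
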